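/- Let $R(z)\in\mathbb{C}(z)^{m\times m}$ be a rational matrix and let $\alpha\in\mathbb{C}$, $\alpha\neq 0$. Write $R^*(z):=[R(\overline{z})]^*$ (only the coefficients are conjugate-transposed). Then $R(z)$ is para-Hermitian, i.e. $R^*(z)=R(1/z)$ (resp. para-skew-Hermitian, i.e. $R^*(z)=-R(1/z)$), if and only if there exists a strongly minimal $*$-palindromic (resp. $*$-anti-palindromic) linearization of $(\alpha+\overline{\alpha}z)R(z)$. Here a strongly minimal linearization of a rational matrix $H(z)\in\mathbb{C}(z)^{m\times m}$ is a pencil $$L(z)=\begin{bmatrix} -A(z) & B(z)\\ C(z) & D(z)\end{bmatrix}=\begin{bmatrix} -(zA_1-A_0) & zB_1-B_0\\ zC_1-C_0 & zD_1-D_0\end{bmatrix}\in\mathbb{C}[z]^{(n+m)\times(n+m)},\qquad n\ge 0,$$ with $A(z)\in\mathbb{C}[z]^{n\times n}$ regular ($\det A(z)\not\equiv 0$), such that $H(z)=D(z)+C(z)A(z)^{-1}B(z)$, such that for every $z_0\in\mathbb{C}$ the matrices $\begin{bmatrix}-A(z_0)&B(z_0)\end{bmatrix}$ and $\begin{bmatrix}-A(z_0)\\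 C(z_0)\end{bmatrix}$ have rank $n$, and such that $\begin{bmatrix}-A_1&B_1\end{bmatrix}$ and $\begin{bmatrix}-A_1\\ C_1\end{bmatrix}$ have rank $n$. (If $n=0$, then $L(z)=D(z)$ and the rank conditions are void.) The pencil $L(z)$ is $*$-palindromic (resp. $*$-anti-palindromic) if $zL^*(1/z)=L(z)$ (resp. $zL^*(1/z)=-L(z)$); that is, the reversal is taken with respect to grade $1$. -/

import Mathlib

open Polynomial

noncomputable section

/-! ### Para-Hermitian rational matrices -/

/-- Complex conjugation of all coefficients of a rational function: the ring homomorphism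
`q(t) ↦ conj (q (conj t))` of `ℂ(t)`. -/
def conjCoeff : RatFunc ℂ →+* RatFunc ℂ :=
  RatFunc.mapRingHom (Polynomial.mapRingHom (starRingEnd ℂ))
    (nonZeroDivisors_le_comap_nonZeroDivisors_of_injective _
      (Polynomial.map_injective _ (starRingEnd ℂ).injective))

/-- No nonzero polynomial vanishes at the element `1/t` of `ℂ(t)`. -/
theorem aeval_inv_X_injective :
    Function.Injective (Polynomial.aeval (R := ℂ) ((RatFunc.X : RatFunc ℂ)⁻¹)) := by
  rw [← transcendental_iff_injective]
  intro h
  have h2 : IsAlgebraic ℂ (RatFunc.X : RatFunc ℂ) := by simpa using h.inv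
  exact RatFunc.transcendental_X h2

/-- The change of variable `q(t) ↦ q(1/t)` of `ℂ(t)`. -/
def substInv : RatFunc ℂ →+* RatFunc ℂ :=
  RatFunc.liftRingHom (Polynomial.aeval (R := ℂ) ((RatFunc.X : RatFunc ℂ)⁻¹)).toRingHom
    (nonZeroDivisors_le_comap_nonZeroDivisors_of_injective _ aeval_inv_X_injective)

/-- `R*(t)`: the conjugate transpose is applied to the coefficients of `R(t)`, not to the
variable, that is `R*(t) = (R (conj t))ᴴ`. -/
def ratStar {m : ℕ} (R : Matrix (Fin m) (Fin m) (RatFunc ℂ)) :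
    Matrix (Fin m) (Fin m) (RatFunc ℂ) :=
  R.transpose.map conjCoeff

/-- `R(1/t)`. -/
def ratInvVar {m : ℕ} (R : Matrix (Fin m) (Fin m) (RatFunc ℂ)) :
    Matrix (Fin m) (Fin m) (RatFunc ℂ) :=
  R.map substInv

/-- `R*(z) = R(1/z)`. -/
def IsParaHermitian {m : ℕ} (R : Matrix (Fin m) (Fin m) (RatFunc ℂ)) : Prop :=
  ratStar R = ratInvVar R

/-- `R*(z) = -R(1/z)`. -/
def IsParaSkewHermitian {m : ℕ} (R : Matrix (Fin m) (Fin m) (RatFunc ℂ)) : Prop :=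
  ratStar R = -ratInvVar R

/-! ### Palindromic matrix polynomials -/

/-- The reversal `t ^ d * P*(1/t)` of `P*`, for a matrix polynomial `P` all of whose entries have
degree at most `d`. -/
def revStar {ι : Type*} (d : ℕ) (P : Matrix ι ι ℂ[X]) : Matrix ι ι ℂ[X] :=
  P.transpose.map fun p => (p.map (starRingEnd ℂ)).reflect d

/-- `P` has degree at most `d` and is `*`-palindromic as a matrix polynomial of grade `d`. -/
def IsStarPalindromic {ι : Type*} (d : ℕ) (P : Matrix ι ι ℂ[X]) : Prop :=
  (∀ i j, (P i j).natDegree ≤ d) ∧ revStar d P = P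

/-- `P` has degree at most `d` and is `*`-anti-palindromic as a matrix polynomial of grade `d`. -/
def IsStarAntiPalindromic {ι : Type*} (d : ℕ) (P : Matrix ι ι ℂ[X]) : Prop :=
  (∀ i j, (P i j).natDegree ≤ d) ∧ revStar d P = -P

/-! ### Linear system matrices -/

/-- The pencil `t M₁ - M₀`. -/
def pencil {ι κ : Type*} (M₁ M₀ : Matrix ι κ ℂ) : Matrix ι κ ℂ[X] :=
  Matrix.of fun i j => X * C (M₁ i j) - C (M₀ i j)

/-- The coefficients of a linear system matrix
`L(t) = [[-(t A₁ - A₀), t B₁ - B₀], [t C₁ - C₀, t D₁ - D₀]]` whose block `A(t) = t A₁ - A₀` is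
regular. The block `A(t)` may be empty (`n = 0`). -/
structure LinearSystemMatrix (n m : ℕ) where
  A₁ : Matrix (Fin n) (Fin n) ℂ
  A₀ : Matrix (Fin n) (Fin n) ℂ
  B₁ : Matrix (Fin n) (Fin m) ℂ
  B₀ : Matrix (Fin n) (Fin m) ℂ
  C₁ : Matrix (Fin m) (Fin n) ℂ
  C₀ : Matrix (Fin m) (Fin n) ℂ
  D₁ : Matrix (Fin m) (Fin m) ℂ
  D₀ : Matrix (Fin m) (Fin m) ℂ
  regular : (pencil A₁ A₀).det ≠ 0

namespace LinearSystemMatrix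

/-- The linear system matrix as a matrix polynomial, `[[-A(t), B(t)], [C(t), D(t)]]`. -/
def toMatrix {n m : ℕ} (L : LinearSystemMatrix n m) :
    Matrix (Fin n ⊕ Fin m) (Fin n ⊕ Fin m) ℂ[X] :=
  Matrix.fromBlocks (-pencil L.A₁ L.A₀) (pencil L.B₁ L.B₀) (pencil L.C₁ L.C₀) (pencil L.D₁ L.D₀)

/-- The transfer function `D(t) + C(t) A(t)⁻¹ B(t)`, a rational matrix. -/
def transferFunction {n m : ℕ} (L : LinearSystemMatrix n m) :
    Matrix (Fin m) (Fin m) (RatFunc ℂ) :=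
  (pencil L.D₁ L.D₀).map (algebraMap ℂ[X] (RatFunc ℂ)) +
    (pencil L.C₁ L.C₀).map (algebraMap ℂ[X] (RatFunc ℂ)) *
      ((pencil L.A₁ L.A₀).map (algebraMap ℂ[X] (RatFunc ℂ)))⁻¹ *
      (pencil L.B₁ L.B₀).map (algebraMap ℂ[X] (RatFunc ℂ))

/-- Minimality (in `ℂ`): `[-A(t₀) B(t₀)]` and `[-A(t₀); C(t₀)]` have full row and column rank,
respectively, for every `t₀ ∈ ℂ`. -/
def IsMinimal {n m : ℕ} (L : LinearSystemMatrix n m) : Prop :=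
  ∀ t₀ : ℂ,
    ((Matrix.fromCols (-pencil L.A₁ L.A₀) (pencil L.B₁ L.B₀)).map (Polynomial.eval t₀)).rank = n ∧
    ((Matrix.fromRows (-pencil L.A₁ L.A₀) (pencil L.C₁ L.C₀)).map (Polynomial.eval t₀)).rank = n

/-- Minimality at infinity: `[-A₁ B₁]` and `[-A₁; C₁]` have full row and column rank,
respectively. -/
def IsMinimalAtInfinity {n m : ℕ} (L : LinearSystemMatrix n m) : Prop :=
  (Matrix.fromCols (-L.A₁) L.B₁).rank = n ∧ (Matrix.fromRows (-L.A₁) L.C₁).rank = n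

/-- Minimal in `ℂ` and at infinity. -/
def IsStronglyMinimal {n m : ℕ} (L : LinearSystemMatrix n m) : Prop :=
  L.IsMinimal ∧ L.IsMinimalAtInfinity

/-- `L` is a strongly minimal linearization of the rational matrix `H`. -/
def IsStronglyMinimalLinearization {n m : ℕ} (L : LinearSystemMatrix n m)
    (H : Matrix (Fin m) (Fin m) (RatFunc ℂ)) : Prop :=
  L.IsStronglyMinimal ∧ L.transferFunction = H

end LinearSystemMatrix

end

/-! ### The involution attached to the unit circle -/

noncomputable section

/-! The factor `α + conj α z` is palindromic of grade 1, so `R` is para-Hermitian exactly when `H =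
(α + conj α z) R` satisfies `z H*(1/z) = H`; multiplication by `i` exchanges the Hermitian and skew
cases. If `L` is palindromic, its blocks obey this relation, with `B` and `C` exchanged, and hence
so does `H` (`transferFunction_of_isStarPalindromic`); minimality plays no role there.

For the existence of `L`, the circle is moved to the real line. Choose `w = v²` on the unit circle,
not a pole of `H`, and let `c = i (conj v z - v)`, which is palindromic with its zero at `w`. The
map `toCircle w` sends the line to the circle and `∞` to `w`, so it turns `H / c` into a rational
matrix `G` that is Hermitian on the line and has at most a simple pole at `∞`. Division with
remainder splits `G` into a Hermitian pencil and a strictly proper part `N / d`.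

That part is realized by residues (`exists_hermitian_realization`). The Hermitian form `Res (u* (N /
d) v)` on vectors of polynomials has a radical of finite codimension, and multiplication by `X` is
self-adjoint for it. With `S` the Gram matrix of the form on the quotient and `T` that of
multiplication by `X`, one gets `N / d = B* (X S - T)⁻¹ B`. Dividing out the radical makes `S`
invertible and the realization observable; by symmetry it is also controllable.

Moving back to the circle and multiplying by `c` turns Hermitian pencils into palindromic ones
(`circlePencil`). Their values are combinations `a S - b T` with `(a, b) ≠ 0`, also at `∞`, so
observability and invertibility of `S` give strong minimality. -/

theorem ratFunc_ringHom_ext {S : Type*} [Semiring S] {f g : RatFunc ℂ →+* S}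
    (hC : ∀ a, f (RatFunc.C a) = g (RatFunc.C a)) (hX : f RatFunc.X = g RatFunc.X) : f = g := by
  refine IsLocalization.ringHom_ext (nonZeroDivisors ℂ[X]) ?_
  refine Polynomial.ringHom_ext (fun a => ?_) ?_
  · simpa using hC a
  · simpa using hX

theorem conjCoeff_algebraMap (p : ℂ[X]) :
    conjCoeff (algebraMap _ _ p) = algebraMap _ _ (p.map (starRingEnd ℂ)) := by
  have := RatFunc.map_apply_div (Polynomial.mapRingHom (starRingEnd ℂ))
    (nonZeroDivisors_le_comap_nonZeroDivisors_of_injective _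
      (Polynomial.map_injective _ (starRingEnd ℂ).injective)) p 1
  simpa [conjCoeff, RatFunc.coe_mapRingHom_eq_coe_map] using this

@[simp] theorem conjCoeff_C (a : ℂ) : conjCoeff (RatFunc.C a) = RatFunc.C (starRingEnd ℂ a) := by
  simpa using conjCoeff_algebraMap (Polynomial.C a)

@[simp] theorem conjCoeff_X : conjCoeff RatFunc.X = RatFunc.X := by
  simpa using conjCoeff_algebraMap Polynomial.X

@[simp] theorem substInv_C (a : ℂ) : substInv (RatFunc.C a) = RatFunc.C a := by
  have := RatFunc.liftRingHom_algebraMap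
    (Polynomial.aeval (R := ℂ) ((RatFunc.X : RatFunc ℂ)⁻¹)).toRingHom
    (nonZeroDivisors_le_comap_nonZeroDivisors_of_injective _ aeval_inv_X_injective)
    (Polynomial.C a)
  simp [substInv]

@[simp] theorem substInv_X : substInv RatFunc.X = (RatFunc.X)⁻¹ := by
  have := RatFunc.liftRingHom_algebraMap
    (Polynomial.aeval (R := ℂ) ((RatFunc.X : RatFunc ℂ)⁻¹)).toRingHom
    (nonZeroDivisors_le_comap_nonZeroDivisors_of_injective _ aeval_inv_X_injective)
    (Polynomial.X)
  simp [substInv]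

@[simp] theorem conjCoeff_conjCoeff (q : RatFunc ℂ) : conjCoeff (conjCoeff q) = q := by
  have : conjCoeff.comp conjCoeff = RingHom.id _ := ratFunc_ringHom_ext (by simp) (by simp)
  exact congrArg (fun f => f q) this

/-- The involution `q(t) ↦ conj (q (1 / conj t))` of `ℂ(t)`. -/
def circleConj : RatFunc ℂ →+* RatFunc ℂ := conjCoeff.comp substInv

@[simp] theorem circleConj_C (a : ℂ) : circleConj (RatFunc.C a) = RatFunc.C (starRingEnd ℂ a) := by
  simp [circleConj]

@[simp] theorem circleConj_X : circleConj RatFunc.X = (RatFunc.X)⁻¹ := by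
  simp [circleConj]

theorem isParaHermitian_iff {m : ℕ} (R : Matrix (Fin m) (Fin m) (RatFunc ℂ)) :
    IsParaHermitian R ↔ R.transpose.map circleConj = R := by
  unfold IsParaHermitian ratStar ratInvVar
  simp only [← Matrix.ext_iff, Matrix.map_apply, Matrix.transpose_apply, circleConj,
    RingHom.comp_apply]
  constructor
  · intro h i j
    rw [← h, conjCoeff_conjCoeff]
  · intro h i j
    rw [← h, conjCoeff_conjCoeff]

theorem RatFunc.C_add_C_mul_X_ne_zero {α β : ℂ} (h : α ≠ 0 ∨ β ≠ 0) :
    (RatFunc.C α + RatFunc.C β * RatFunc.X : RatFunc ℂ) ≠ 0 := by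
  have h1 : (RatFunc.C α + RatFunc.C β * RatFunc.X : RatFunc ℂ) =
      algebraMap ℂ[X] _ (Polynomial.C α + Polynomial.C β * Polynomial.X) := by simp
  rw [h1]
  refine RatFunc.algebraMap_ne_zero fun h0 => ?_
  have e0 := congrArg (fun p => coeff p 0) h0
  have e1 := congrArg (fun p => coeff p 1) h0
  simp [coeff_C] at e0 e1
  tauto

/-- `R` is para-Hermitian iff `H = (α + conj α t) R` satisfies `t H*(1/t) = H`. -/
theorem isParaHermitian_iff_smul {m : ℕ} (R : Matrix (Fin m) (Fin m) (RatFunc ℂ)) {α : ℂ}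
    (hα : α ≠ 0) {H : Matrix (Fin m) (Fin m) (RatFunc ℂ)}
    (hH : H = (RatFunc.C α + RatFunc.C (starRingEnd ℂ α) * RatFunc.X) • R) :
    IsParaHermitian R ↔ (RatFunc.X : RatFunc ℂ) • H.transpose.map circleConj = H := by
  rw [isParaHermitian_iff, hH]
  have h0 := RatFunc.C_add_C_mul_X_ne_zero (α := α) (β := starRingEnd ℂ α) (Or.inl hα)
  have hX : (RatFunc.X : RatFunc ℂ) ≠ 0 := RatFunc.X_ne_zero (K := ℂ)
  simp only [← Matrix.ext_iff, Matrix.map_apply, Matrix.transpose_apply, Matrix.smul_apply,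
    smul_eq_mul, map_mul, map_add, circleConj_C, circleConj_X, Complex.conj_conj, ← mul_assoc]
  have e : RatFunc.X * (RatFunc.C (starRingEnd ℂ α) + RatFunc.C α * RatFunc.X⁻¹) =
      (RatFunc.C α + RatFunc.C (starRingEnd ℂ α) * RatFunc.X) := by
    field_simp
    ring
  simp only [e, mul_right_inj' h0]

/-- Conjugation changes the sign of `i` while `substInv` fixes it, so the skew case reduces to the
Hermitian one. -/
theorem isParaSkewHermitian_iff {m : ℕ} (R : Matrix (Fin m) (Fin m) (RatFunc ℂ)) :
    IsParaSkewHermitian R ↔ IsParaHermitian (RatFunc.C Complex.I • R) := by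
  unfold IsParaHermitian IsParaSkewHermitian ratStar ratInvVar
  have hI : (RatFunc.C Complex.I : RatFunc ℂ) ≠ 0 := by simp
  simp only [← Matrix.ext_iff, Matrix.map_apply, Matrix.transpose_apply, Matrix.smul_apply,
    smul_eq_mul, map_mul, conjCoeff_C, substInv_C, Complex.conj_I, map_neg, Matrix.neg_apply,
    neg_mul]
  refine forall_congr' fun i => forall_congr' fun j => ?_
  rw [neg_eq_iff_eq_neg, ← mul_neg, mul_right_inj' hI]

/-! ### Scaling, and symmetry of the transfer function -/

namespace LinearSystemMatrix

theorem isUnit_det_map {n m : ℕ} (L : LinearSystemMatrix n m) :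
    IsUnit ((pencil L.A₁ L.A₀).map (algebraMap ℂ[X] (RatFunc ℂ))).det := by
  rw [isUnit_iff_ne_zero]
  have := RingHom.map_det (algebraMap ℂ[X] (RatFunc ℂ)) (pencil L.A₁ L.A₀)
  rw [RingHom.mapMatrix_apply] at this
  rw [← this]
  exact RatFunc.algebraMap_ne_zero L.regular

theorem pencil_smul {ι κ : Type*} (k : ℂ) (M₁ M₀ : Matrix ι κ ℂ) :
    pencil (k • M₁) (k • M₀) = Polynomial.C k • pencil M₁ M₀ := by
  ext1 i j
  simp [pencil, mul_sub]
  ring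

/-- The linear system matrix `k L`. -/
def smul {n m : ℕ} (k : ℂ) (hk : k ≠ 0) (L : LinearSystemMatrix n m) : LinearSystemMatrix n m where
  A₁ := k • L.A₁
  A₀ := k • L.A₀
  B₁ := k • L.B₁
  B₀ := k • L.B₀
  C₁ := k • L.C₁
  C₀ := k • L.C₀
  D₁ := k • L.D₁
  D₀ := k • L.D₀
  regular := by
    rw [pencil_smul, Matrix.det_smul]
    exact mul_ne_zero (pow_ne_zero _ (by simpa using hk)) L.regular

theorem smul_toMatrix {n m : ℕ} (k : ℂ) (hk : k ≠ 0) (L : LinearSystemMatrix n m) :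
    (L.smul k hk).toMatrix = Polynomial.C k • L.toMatrix := by
  simp only [toMatrix, smul, pencil_smul, Matrix.fromBlocks_smul, smul_neg]

theorem map_smul_C {ι κ : Type*} (k : ℂ) (M : Matrix ι κ ℂ[X]) :
    (Polynomial.C k • M).map (algebraMap ℂ[X] (RatFunc ℂ)) =
      RatFunc.C k • M.map (algebraMap ℂ[X] (RatFunc ℂ)) := by
  ext1 i j
  simp

theorem transferFunction_smul {n m : ℕ} (k : ℂ) (hk : k ≠ 0) (L : LinearSystemMatrix n m) :
    (L.smul k hk).transferFunction = RatFunc.C k • L.transferFunction := by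
  have hk' : (RatFunc.C k : RatFunc ℂ) ≠ 0 := by simpa using hk
  have hdet := L.isUnit_det_map
  have hinv := Matrix.inv_smul' ((pencil L.A₁ L.A₀).map (algebraMap ℂ[X] (RatFunc ℂ)))
    (Units.mk0 _ hk') hdet
  rw [Units.smul_def, Units.smul_def, Units.val_mk0, Units.val_inv_eq_inv_val, Units.val_mk0] at hinv
  simp only [transferFunction, smul, pencil_smul, map_smul_C, hinv, smul_add, Matrix.smul_mul,
    Matrix.mul_smul, smul_smul]
  rw [inv_mul_cancel₀ hk', mul_one]

theorem rank_smul {ι κ : Type*} [Fintype κ] [Fintype ι] [DecidableEq κ] {k : ℂ} (hk : k ≠ 0) (M : Matrix ι κ ℂ) :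
    (k • M).rank = M.rank := by
  have : k • M = M * (k • (1 : Matrix κ κ ℂ)) := by simp
  rw [this]
  refine Matrix.rank_mul_eq_left_of_isUnit_det _ _ ?_
  simp [hk]

theorem IsStronglyMinimal.smul {n m : ℕ} {k : ℂ} (hk : k ≠ 0) {L : LinearSystemMatrix n m}
    (h : L.IsStronglyMinimal) : (L.smul k hk).IsStronglyMinimal := by
  have e {ι κ : Type} (t : ℂ) (M : Matrix ι κ ℂ[X]) :
      (Polynomial.C k • M).map (Polynomial.eval t) = k • M.map (Polynomial.eval t) := by
    ext1 i j
    simp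
  have e1 {ι κ κ' S : Type} [Ring S] (s : S) (M : Matrix ι κ S) (N : Matrix ι κ' S) :
      Matrix.fromCols (-(s • M)) (s • N) = s • Matrix.fromCols (-M) N := by
    ext1 i j
    rcases j with j | j <;> simp
  have e2 {ι κ κ' S : Type} [Ring S] (s : S) (M : Matrix κ ι S) (N : Matrix κ' ι S) :
      Matrix.fromRows (-(s • M)) (s • N) = s • Matrix.fromRows (-M) N := by
    ext1 i j
    rcases i with i | i <;> simp
  refine ⟨fun t => ?_, ?_⟩
  · simp only [LinearSystemMatrix.smul, pencil_smul, e1, e2, e, rank_smul hk]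
    exact h.1 t
  · simp only [IsMinimalAtInfinity, LinearSystemMatrix.smul, e1, e2, rank_smul hk]
    exact h.2

theorem revStar_smul {ι : Type*} (d : ℕ) (k : ℂ) (P : Matrix ι ι ℂ[X]) :
    revStar d (Polynomial.C k • P) = Polynomial.C (starRingEnd ℂ k) • revStar d P := by
  ext1 i j
  simp [revStar, Polynomial.reflect_C_mul]

theorem isStarPalindromic_smul_I {ι : Type*} {d : ℕ} {P : Matrix ι ι ℂ[X]}
    (h : IsStarAntiPalindromic d P) : IsStarPalindromic d (Polynomial.C Complex.I • P) := by
  refine ⟨fun i j => (Polynomial.natDegree_C_mul_le _ _).trans (h.1 i j), ?_⟩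
  rw [revStar_smul, h.2]
  simp

theorem isStarAntiPalindromic_smul_neg_I {ι : Type*} {d : ℕ} {P : Matrix ι ι ℂ[X]}
    (h : IsStarPalindromic d P) : IsStarAntiPalindromic d (Polynomial.C (-Complex.I) • P) := by
  refine ⟨fun i j => (Polynomial.natDegree_C_mul_le _ _).trans (h.1 i j), ?_⟩
  rw [revStar_smul, h.2]
  simp

theorem IsStronglyMinimalLinearization.smul {n m : ℕ} {k : ℂ} (hk : k ≠ 0)
    {L : LinearSystemMatrix n m} {H : Matrix (Fin m) (Fin m) (RatFunc ℂ)}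
    (h : L.IsStronglyMinimalLinearization H) :
    (L.smul k hk).IsStronglyMinimalLinearization (RatFunc.C k • H) :=
  ⟨h.1.smul hk, by rw [transferFunction_smul, h.2]⟩

/-- A transfer function of a `*`-palindromic linear system matrix satisfies `t H*(1/t) = H`. -/
theorem transferFunction_of_isStarPalindromic {n m : ℕ} (L : LinearSystemMatrix n m)
    (h : IsStarPalindromic 1 L.toMatrix) :
    (RatFunc.X : RatFunc ℂ) • L.transferFunction.transpose.map circleConj = L.transferFunction := by
  have hX : (RatFunc.X : RatFunc ℂ) ≠ 0 := RatFunc.X_ne_zero (K := ℂ)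
  -- Over `ℂ(z)`, reversal in grade 1 is `circleConj` of the transpose times `X`.
  have key {ι κ : Type} (M₁ M₀ : Matrix ι κ ℂ) (N₁ N₀ : Matrix κ ι ℂ)
      (hM : ∀ i j, ((pencil M₁ M₀ i j).map (starRingEnd ℂ)).reflect 1 = pencil N₁ N₀ j i) :
      (pencil N₁ N₀).map (algebraMap ℂ[X] (RatFunc ℂ)) =
        (RatFunc.X : RatFunc ℂ) • ((pencil M₁ M₀).map (algebraMap ℂ[X] (RatFunc ℂ))).transpose.map circleConj := by
    ext1 i j
    simp only [Matrix.map_apply, Matrix.smul_apply, Matrix.transpose_apply, ← hM, smul_eq_mul]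
    simp only [pencil, Matrix.of_apply, Polynomial.map_sub, Polynomial.map_mul, Polynomial.map_X,
      Polynomial.map_C, Polynomial.reflect_sub, map_sub, map_mul, RatFunc.algebraMap_X,
      RatFunc.algebraMap_C, circleConj_C, circleConj_X, Polynomial.reflect_C, mul_comm Polynomial.X,
      Polynomial.reflect_C_mul, Polynomial.reflect_one_X, pow_one, mul_one]
    field_simp
  have hrev : ∀ i j, ((L.toMatrix i j).map (starRingEnd ℂ)).reflect 1 = L.toMatrix j i :=
    fun i j => congrFun (congrFun h.2 j) i
  have hA := key L.A₁ L.A₀ L.A₁ L.A₀ fun i j => by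
    simpa [toMatrix, Polynomial.reflect_neg] using hrev (Sum.inl i) (Sum.inl j)
  have hB := key L.B₁ L.B₀ L.C₁ L.C₀ fun i j => by
    simpa [toMatrix] using hrev (Sum.inl i) (Sum.inr j)
  have hC := key L.C₁ L.C₀ L.B₁ L.B₀ fun i j => by
    simpa [toMatrix] using hrev (Sum.inr i) (Sum.inl j)
  have hD := key L.D₁ L.D₀ L.D₁ L.D₀ fun i j => by
    simpa [toMatrix] using hrev (Sum.inr i) (Sum.inr j)
  unfold transferFunction
  have hdet := L.isUnit_det_map
  generalize (pencil L.A₁ L.A₀).map (algebraMap ℂ[X] (RatFunc ℂ)) = A at *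
  generalize (pencil L.B₁ L.B₀).map (algebraMap ℂ[X] (RatFunc ℂ)) = B at *
  generalize (pencil L.C₁ L.C₀).map (algebraMap ℂ[X] (RatFunc ℂ)) = C at *
  generalize (pencil L.D₁ L.D₀).map (algebraMap ℂ[X] (RatFunc ℂ)) = D at *
  -- `B` and `C` each contribute a factor `X` and `A⁻¹` contributes `X⁻¹`, which leaves the single
  -- `X` required.
  have hinv : A⁻¹ = (RatFunc.X : RatFunc ℂ)⁻¹ • (A⁻¹).transpose.map circleConj := by
    refine Matrix.inv_eq_right_inv ?_
    conv_lhs => enter [1]; rw [hA]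
    rw [Matrix.smul_mul, Matrix.mul_smul, smul_smul, mul_inv_cancel₀ hX, one_smul,
      ← Matrix.map_mul, ← Matrix.transpose_mul, Matrix.nonsing_inv_mul _ hdet]
    simp
  simp only [Matrix.transpose_add, Matrix.transpose_mul]
  rw [Matrix.map_add _ (map_add circleConj), smul_add, ← hD]
  congr 1
  rw [Matrix.map_mul, Matrix.map_mul]
  generalize B.transpose.map circleConj = B' at *
  generalize C.transpose.map circleConj = C' at *
  conv_rhs => rw [hinv, hB, hC]
  simp only [Matrix.smul_mul, Matrix.mul_smul, smul_smul, Matrix.mul_assoc]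
  rw [inv_mul_cancel₀ hX, mul_one]

end LinearSystemMatrix
end

/-! ### Gram matrices and residues at infinity -/

open scoped Matrix

noncomputable section

/-- A Hermitian form whose radical has finite codimension is represented by an invertible Gram
matrix. -/
theorem exists_gram_matrix {V : Type*} [AddCommGroup V] [Module ℂ V]
    (h : V →ₗ⋆[ℂ] V →ₗ[ℂ] ℂ) (hh : ∀ u v, starRingEnd ℂ (h u v) = h v u)
    (hfin : Module.Finite ℂ (V ⧸ LinearMap.ker h.flip)) :
    ∃ (n : ℕ) (b : Fin n → V) (S : Matrix (Fin n) (Fin n) ℂ), (∀ i j, S i j = h (b i) (b j)) ∧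
      IsUnit S ∧
      ∀ u v, h u v = (fun i => h u (b i)) ⬝ᵥ (S⁻¹ *ᵥ fun j => h (b j) v) := by
  classical
  set W := LinearMap.ker h.flip with hW
  let e := Module.finBasis ℂ (V ⧸ W)
  set n := Module.finrank ℂ (V ⧸ W)
  choose b hb using fun i => W.mkQ_surjective (e i)
  let c : V → Fin n → ℂ := fun v i => e.repr (W.mkQ v) i
  have hdec : ∀ v, v - ∑ i, c v i • b i ∈ W := by
    intro v
    rw [← Submodule.ker_mkQ W, LinearMap.mem_ker, map_sub, map_sum]
    simp only [map_smul, hb, c]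
    rw [e.sum_repr, sub_self]
  have hexp : ∀ u v, h u v = ∑ i, c v i * h u (b i) := by
    intro u v
    have h1 : h u (v - ∑ i, c v i • b i) = 0 := by
      have := hdec v
      rw [hW, LinearMap.mem_ker] at this
      simpa using congrArg (fun f => f u) this
    rw [map_sub, map_sum, sub_eq_zero] at h1
    simpa using h1
  let S : Matrix (Fin n) (Fin n) ℂ := Matrix.of fun i j => h (b i) (b j)
  have hS : IsUnit S := by
    rw [← Matrix.mulVec_injective_iff_isUnit, ← Matrix.coe_mulVecLin, ← LinearMap.ker_eq_bot,
      LinearMap.ker_eq_bot']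
    intro x hx
    -- A kernel vector of `S` gives a combination orthogonal to every `b i`, hence to everything;
    -- but the `b i` are independent modulo the radical `W`.
    have h1 : ∑ i, x i • b i ∈ W := by
      rw [hW, LinearMap.mem_ker]
      ext u
      simp only [LinearMap.flip_apply, LinearMap.zero_apply]
      rw [← hh, map_eq_zero, hexp]
      refine Finset.sum_eq_zero fun i _ => ?_
      have h2 := congrFun hx i
      simp only [Matrix.mulVecLin_apply, Matrix.mulVec, dotProduct, S, Matrix.of_apply,
        Pi.zero_apply] at h2
      have h3 : h (b i) (∑ i, x i • b i) = 0 := by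
        rw [← h2, map_sum]
        exact Finset.sum_congr rfl fun j _ => by simp [mul_comm]
      rw [← hh, h3]
      simp
    rw [← Submodule.ker_mkQ W, LinearMap.mem_ker, map_sum] at h1
    simp only [map_smul, hb] at h1
    exact funext (Fintype.linearIndependent_iff.mp e.linearIndependent x h1)
  refine ⟨n, b, S, fun _ _ => rfl, hS, fun u v => ?_⟩
  -- The coordinates of `v` modulo `W` are thus `S⁻¹` applied to its pairings with the `b j`.
  have hc : (fun j => h (b j) v) = S *ᵥ c v := by
    ext j
    rw [hexp]
    simp [Matrix.mulVec, dotProduct, S, mul_comm]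
  rw [hc, Matrix.mulVec_mulVec, Matrix.nonsing_inv_mul _ ((Matrix.isUnit_iff_isUnit_det _).mp hS),
    Matrix.one_mulVec, hexp]
  simp [dotProduct, mul_comm]

/-- The coefficient of `X⁻¹` in the expansion of `f / d` at infinity, for monic `d`. -/
def residueInf (d : ℂ[X]) : ℂ[X] →ₗ[ℂ] ℂ :=
  Polynomial.lcoeff ℂ (d.natDegree - 1) ∘ₗ Polynomial.modByMonicHom d

theorem residueInf_apply (d f : ℂ[X]) :
    residueInf d f = (f %ₘ d).coeff (d.natDegree - 1) := rfl

theorem residueInf_mul_left {d : ℂ[X]} (hd : d.Monic) (f : ℂ[X]) : residueInf d (d * f) = 0 := by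
  rw [residueInf_apply, (Polynomial.modByMonic_eq_zero_iff_dvd hd).mpr (dvd_mul_right d f)]
  simp

theorem residueInf_add_mul {d : ℂ[X]} (hd : d.Monic) (f g : ℂ[X]) :
    residueInf d (g + d * f) = residueInf d g := by
  rw [map_add, residueInf_mul_left hd, add_zero]

theorem residueInf_conj {d : ℂ[X]} (hd : d.Monic) (hdr : d.map (starRingEnd ℂ) = d) (f : ℂ[X]) :
    starRingEnd ℂ (residueInf d f) = residueInf d (f.map (starRingEnd ℂ)) := by
  rw [residueInf_apply, residueInf_apply]
  conv_rhs => rw [← hdr, ← Polynomial.map_modByMonic _ hd, hdr]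
  rw [Polynomial.coeff_map]

/-- `k`-fold `divX`. -/
theorem coeff_divX_iterate (d : ℂ[X]) (k n : ℕ) :
    (Polynomial.divX^[k] d).coeff n = d.coeff (n + k) := by
  induction k generalizing n with
  | zero => simp
  | succ k ih => rw [Function.iterate_succ_apply', coeff_divX, ih]; congr 1; ring

/-- The Horner quotients of `d` are dual to the powers of `X` under the residue. For `r ≤ k` the
product is already reduced modulo `d`, and the residue reads the coefficient of `d` at `deg d + k -
r`. -/
theorem residueInf_divX_mul {d : ℂ[X]} (hd : d.Monic) {k r : ℕ} (hr : r < d.natDegree) :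
    residueInf d (Polynomial.divX^[k + 1] d * X ^ r) = if k = r then 1 else 0 := by
  have hlow : ∀ f : ℂ[X], f.degree < d.degree →
      residueInf d f = f.coeff (d.natDegree - 1) := by
    intro f hf
    rw [residueInf_apply, (Polynomial.modByMonic_eq_self_iff hd).mpr hf]
  have hdeg : d.degree = d.natDegree := Polynomial.degree_eq_natDegree hd.ne_zero
  by_cases hkr : r ≤ k
  · rw [hlow, Polynomial.coeff_mul_X_pow', if_pos (by omega), coeff_divX_iterate]
    · split_ifs with h
      · subst h
        rw [show d.natDegree - 1 - k + (k + 1) = d.natDegree by omega]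
        exact hd
      · exact Polynomial.coeff_eq_zero_of_natDegree_lt (by omega)
    · rw [hdeg, Polynomial.degree_lt_iff_coeff_zero]
      intro j hj
      rw [Polynomial.coeff_mul_X_pow', if_pos (by omega), coeff_divX_iterate]
      exact Polynomial.coeff_eq_zero_of_natDegree_lt (by omega)
  · rw [if_neg (by omega)]
    obtain ⟨s, rfl⟩ : ∃ s, r = k + 1 + s := ⟨r - (k + 1), by omega⟩
    -- `divX^[k + 1] d * X ^ (k + 1)` is `d` without its terms of degree at most `k`; subtracting `d
    -- * X ^ s` leaves degree at most `k + s = r - 1`, too low for a residue.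
    have e : Polynomial.divX^[k + 1] d * X ^ (k + 1 + s) =
        (Polynomial.divX^[k + 1] d * X ^ (k + 1) - d) * X ^ s + d * X ^ s := by
      rw [pow_add]; ring
    have hc : ∀ j, k < j → (Polynomial.divX^[k + 1] d * X ^ (k + 1) - d).coeff j = 0 := by
      intro j hj
      rw [Polynomial.coeff_sub, Polynomial.coeff_mul_X_pow', if_pos (by omega), coeff_divX_iterate,
        show j - (k + 1) + (k + 1) = j by omega, sub_self]
    rw [e, residueInf_add_mul hd, hlow]
    · rw [Polynomial.coeff_mul_X_pow', if_pos (by omega)]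
      exact hc _ (by omega)
    · rw [hdeg, Polynomial.degree_lt_iff_coeff_zero]
      intro j hj
      rw [Polynomial.coeff_mul_X_pow', if_pos (by omega)]
      exact hc _ (by omega)

theorem sum_residueInf_divX_mul {d : ℂ[X]} (hd : d.Monic) {f : ℂ[X]} (hf : f.degree < d.degree) :
    ∑ k ∈ Finset.range d.natDegree, C (residueInf d (Polynomial.divX^[k + 1] d * f)) * X ^ k = f := by
  have hdeg : d.degree = d.natDegree := Polynomial.degree_eq_natDegree hd.ne_zero
  rw [hdeg] at hf
  have hsum : f = ∑ r ∈ Finset.range d.natDegree, C (f.coeff r) * X ^ r := by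
    by_cases h0 : f = 0
    · simp [h0]
    · exact Polynomial.as_sum_range_C_mul_X_pow' _ ((Polynomial.natDegree_lt_iff_degree_lt h0).mpr hf)
  conv_rhs => rw [hsum]
  refine Finset.sum_congr rfl fun k hk => ?_
  congr 2
  conv_lhs => rw [hsum]
  rw [Finset.mul_sum, map_sum]
  have : ∀ r ∈ Finset.range d.natDegree,
      residueInf d (Polynomial.divX^[k + 1] d * (C (f.coeff r) * X ^ r)) =
        if k = r then f.coeff r else 0 := by
    intro r hr
    rw [mul_left_comm, ← Polynomial.smul_eq_C_mul, map_smul,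
      residueInf_divX_mul hd (Finset.mem_range.mp hr)]
    split_ifs <;> simp
  rw [Finset.sum_congr rfl this, Finset.sum_ite_eq, if_pos hk]

end

/-! ### Hermitian realization of a strictly proper matrix -/

noncomputable section

theorem pencil_eq {ι κ : Type*} (M₁ M₀ : Matrix ι κ ℂ) :
    pencil M₁ M₀ = (X : ℂ[X]) • M₁.map C - M₀.map C := by
  ext1 i j
  simp [pencil]

/-- The sesquilinear form `(u, v) ↦ Res (u* (N / d) v)` on vectors of polynomials. -/
def residueForm {m : ℕ} (d : ℂ[X]) (N : Matrix (Fin m) (Fin m) ℂ[X]) :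
    (Fin m → ℂ[X]) →ₗ⋆[ℂ] (Fin m → ℂ[X]) →ₗ[ℂ] ℂ :=
  LinearMap.mk₂'ₛₗ (starRingEnd ℂ) (RingHom.id ℂ)
    (fun u v => residueInf d ((fun i => (u i).map (starRingEnd ℂ)) ⬝ᵥ (N *ᵥ v)))
    (fun u u' v => by
      rw [← map_add, ← add_dotProduct]
      congr 2
      ext1 i
      simp)
    (fun c u v => by
      rw [← map_smul]
      congr 1
      rw [smul_eq_C_mul, dotProduct, dotProduct, Finset.mul_sum]
      refine Finset.sum_congr rfl fun i _ => ?_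
      rw [Pi.smul_apply, smul_eq_C_mul, Polynomial.map_mul, map_C, mul_assoc])
    (fun u v v' => by rw [← map_add, ← dotProduct_add, ← Matrix.mulVec_add])
    (fun c u v => by rw [RingHom.id_apply, ← map_smul, ← dotProduct_smul, ← Matrix.mulVec_smul])

variable {m : ℕ} {d : ℂ[X]} {N : Matrix (Fin m) (Fin m) ℂ[X]}

theorem residueForm_apply (u v : Fin m → ℂ[X]) :
    residueForm d N u v =
      residueInf d ((fun i => (u i).map (starRingEnd ℂ)) ⬝ᵥ (N *ᵥ v)) := rfl

theorem residueForm_conj (hd : d.Monic) (hdr : d.map (starRingEnd ℂ) = d)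
    (hN : ∀ i j, (N i j).map (starRingEnd ℂ) = N j i) (u v : Fin m → ℂ[X]) :
    starRingEnd ℂ (residueForm d N u v) = residueForm d N v u := by
  rw [residueForm_apply, residueForm_apply, residueInf_conj hd hdr]
  congr 1
  simp only [dotProduct, Matrix.mulVec, Polynomial.map_sum, Polynomial.map_mul, Finset.mul_sum, hN,
    Polynomial.map_map]
  rw [Finset.sum_comm]
  refine Finset.sum_congr rfl fun i _ => Finset.sum_congr rfl fun j _ => ?_
  have : (starRingEnd ℂ).comp (starRingEnd ℂ) = RingHom.id ℂ := by ext; simp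
  rw [this, Polynomial.map_id]
  ring

/-- For `p = X` this is self-adjointness of multiplication by `X`, which makes `T` Hermitian. -/
theorem residueForm_smul_left {p : ℂ[X]} (u v : Fin m → ℂ[X]) :
    residueForm d N (p • u) v = residueForm d N u (p.map (starRingEnd ℂ) • v) := by
  rw [residueForm_apply, residueForm_apply, Matrix.mulVec_smul, dotProduct_smul, ← smul_dotProduct]
  congr 2
  ext1 i
  simp

theorem residueForm_smul_self (hd : d.Monic) (u v : Fin m → ℂ[X]) :
    residueForm d N u (d • v) = 0 := by
  rw [residueForm_apply, Matrix.mulVec_smul, dotProduct_smul, smul_eq_mul, residueInf_mul_left hd]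

theorem residueForm_single (i j : Fin m) (p : ℂ[X]) :
    residueForm d N (Pi.single i 1) (p • Pi.single j 1) = residueInf d (p * N i j) := by
  rw [residueForm_apply, Matrix.mulVec_smul, dotProduct_smul, smul_eq_mul]
  congr 2
  have : (fun k => ((Pi.single i 1 : Fin m → ℂ[X]) k).map (starRingEnd ℂ)) = Pi.single i 1 := by
    ext1 k
    by_cases h : k = i
    · subst h; simp
    · simp [h]
  rw [this]
  simp

/-- The form sees `v` only through the remainder of `N v` modulo `d`, which has finitely many
coefficients. -/
theorem finite_quotient_radical_residueForm (hd : d.Monic) :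
    Module.Finite ℂ ((Fin m → ℂ[X]) ⧸ LinearMap.ker (residueForm d N).flip) := by
  let Ψ : (Fin m → ℂ[X]) →ₗ[ℂ] (Fin m → Fin d.natDegree → ℂ) :=
    { toFun := fun v i k => (modByMonicHom d ((N *ᵥ v) i)).coeff k
      map_add' := fun u v => by
        ext i k
        rw [Matrix.mulVec_add, Pi.add_apply, map_add, coeff_add]; rfl
      map_smul' := fun c v => by
        ext i k
        rw [Matrix.mulVec_smul, Pi.smul_apply, map_smul, coeff_smul]; rfl }
  have hle : LinearMap.ker Ψ ≤ LinearMap.ker (residueForm d N).flip := by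
    intro v hv
    rw [LinearMap.mem_ker] at hv ⊢
    have hdvd : ∀ i, ∃ q, (N *ᵥ v) i = d * q := by
      intro i
      refine (modByMonic_eq_zero_iff_dvd hd).mp ?_
      ext k
      by_cases hk : k < d.natDegree
      · exact congrFun (congrFun hv i) ⟨k, hk⟩
      · refine coeff_eq_zero_of_degree_lt ((degree_modByMonic_lt _ hd).trans_le ?_)
        rw [degree_eq_natDegree hd.ne_zero]
        exact_mod_cast not_lt.mp hk
    choose q hq using hdvd
    ext u
    rw [LinearMap.flip_apply, residueForm_apply, funext hq]
    have : (fun i => d * q i) = d • q := rfl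
    rw [this, dotProduct_smul, smul_eq_mul, residueInf_mul_left hd]
    rfl
  have : Module.Finite ℂ ((Fin m → ℂ[X]) ⧸ LinearMap.ker Ψ) :=
    Module.Finite.equiv Ψ.quotKerEquivRange.symm
  exact Module.Finite.of_surjective (Submodule.factor hle) (Submodule.factor_surjective hle)

/-- `Y / d` plays the role of `(X S - T)⁻¹ B`. The columns of `S⁻¹ * G p` are the coordinates of `p
• e j` modulo the radical, and `Y` is the Horner form of `(d(X) - d(M)) / (X - M)` applied to the `e
j`, with `M` multiplication by the variable on the quotient. -/
theorem exists_hermitian_realization (hd : d.Monic) (hdr : d.map (starRingEnd ℂ) = d)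
    (hN : ∀ i j, (N i j).map (starRingEnd ℂ) = N j i) (hdeg : ∀ i j, (N i j).degree < d.degree) :
    ∃ (n : ℕ) (S T : Matrix (Fin n) (Fin n) ℂ) (B : Matrix (Fin n) (Fin m) ℂ)
      (Y : Matrix (Fin n) (Fin m) ℂ[X]),
      Sᴴ = S ∧ Tᴴ = T ∧ IsUnit S ∧
      (∀ (a : ℂ) (x : Fin n → ℂ), (a • S - T) *ᵥ x = 0 → Bᴴ *ᵥ x = 0 → x = 0) ∧
      pencil S T * Y = d • B.map C ∧ Bᴴ.map C * Y = N := by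
  have hherm := residueForm_conj hd hdr hN
  obtain ⟨n, b, S, hSb, hS, hgram⟩ := exists_gram_matrix (residueForm d N) hherm
    (finite_quotient_radical_residueForm hd)
  set h := residueForm d N with h_def
  have hX : ∀ u v, h ((X : ℂ[X]) • u) v = h u ((X : ℂ[X]) • v) := fun u v => by
    rw [residueForm_smul_left, map_X]
  let e : Fin m → Fin m → ℂ[X] := fun j => Pi.single j 1
  let T : Matrix (Fin n) (Fin n) ℂ := Matrix.of fun i j => h (b i) ((X : ℂ[X]) • b j)
  let G : ℂ[X] → Matrix (Fin n) (Fin m) ℂ := fun p => Matrix.of fun i j => h (b i) (p • e j)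
  have hBG : ∀ p, (G 1)ᴴ * (S⁻¹ * G p) = Matrix.of fun i j => residueInf d (p * N i j) := by
    intro p
    ext i j
    rw [Matrix.of_apply, ← residueForm_single, ← h_def, hgram]
    simp only [Matrix.mul_apply, dotProduct, Matrix.mulVec, Matrix.conjTranspose_apply]
    refine Finset.sum_congr rfl fun k _ => ?_
    congr 1
    change starRingEnd ℂ (h (b k) ((1 : ℂ[X]) • e i)) = _
    rw [hherm, one_smul]
  have hTG : ∀ p, T * (S⁻¹ * G p) = G (X * p) := by
    intro p
    ext i j
    change _ = h (b i) ((X * p) • e j)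
    rw [mul_smul, ← hX, hgram]
    simp only [Matrix.mul_apply, dotProduct, Matrix.mulVec]
    refine Finset.sum_congr rfl fun k _ => ?_
    congr 1
    change h (b i) ((X : ℂ[X]) • b k) = _
    rw [hX]
  have hCsmul : ∀ (c : ℂ) (v : Fin m → ℂ[X]), C c • v = c • v := fun c v => by
    ext1 i
    simp [smul_eq_C_mul]
  have hSS : IsUnit S.det := (Matrix.isUnit_iff_isUnit_det _).mp hS
  refine ⟨n, S, T, G 1, ∑ k ∈ Finset.range d.natDegree,
    (X ^ k : ℂ[X]) • (S⁻¹ * G (divX^[k + 1] d)).map C, ?_, ?_, hS, ?_, ?_, ?_⟩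
  · ext i j
    rw [Matrix.conjTranspose_apply, hSb, hSb]
    exact hherm _ _
  · ext i j
    change starRingEnd ℂ (h (b j) ((X : ℂ[X]) • b i)) = h (b i) ((X : ℂ[X]) • b j)
    rw [hherm, hX]
  · intro a x hx hBx
    obtain ⟨u, hu⟩ : ∃ u, u = ∑ i, x i • b i := ⟨_, rfl⟩
    have h1 : ∀ i, h (b i) ((X : ℂ[X]) • u) = a * h (b i) u := by
      intro i
      have := congrFun hx i
      rw [Matrix.sub_mulVec, Matrix.smul_mulVec, Pi.sub_apply, Pi.zero_apply, sub_eq_zero] at this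
      simp only [Pi.smul_apply, Matrix.mulVec, dotProduct, hSb, smul_eq_mul] at this
      rw [hu, Finset.smul_sum, map_sum, map_sum]
      simp only [smul_comm (X : ℂ[X]) (x _), map_smul, smul_eq_mul]
      simp only [mul_comm (x _)]
      rw [this]
      rfl
    have h2 : ∀ v, h v ((X : ℂ[X]) • u) = a * h v u := by
      intro v
      rw [hgram, hgram v u, funext h1]
      have : (fun i => a * h (b i) u) = a • fun i => h (b i) u := rfl
      rw [this, Matrix.mulVec_smul, dotProduct_smul, smul_eq_mul]
    have h3 : ∀ i, h (e i) u = 0 := by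
      intro i
      have := congrFun hBx i
      rw [hu, map_sum]
      simp only [map_smul, smul_eq_mul]
      refine Eq.trans ?_ this
      simp only [Matrix.mulVec, dotProduct, Matrix.conjTranspose_apply]
      refine Finset.sum_congr rfl fun k _ => ?_
      rw [mul_comm]
      congr 1
      change _ = starRingEnd ℂ (h (b k) ((1 : ℂ[X]) • e i))
      rw [hherm, one_smul]
    have h4 : ∀ i (p : ℂ[X]), h (p • e i) u = 0 := by
      intro i p
      induction p using Polynomial.induction_on' with
      | add p q hp hq => rw [add_smul, map_add, LinearMap.add_apply, hp, hq, add_zero]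
      | monomial k c =>
        induction k with
        | zero =>
          rw [monomial_zero_left, hCsmul, map_smulₛₗ, LinearMap.smul_apply, h3, smul_zero]
        | succ k ih =>
          have : monomial (k + 1) c = X * monomial k c := by rw [X_mul, monomial_mul_X]
          rw [this, mul_smul, hX, h2, ih, mul_zero]
    have h5 : ∀ v, h v u = 0 := by
      intro v
      have : v = ∑ i, v i • e i := (pi_eq_sum_univ' v).trans (by
        refine Finset.sum_congr rfl fun i _ => ?_
        congr 1)
      rw [this, map_sum, LinearMap.sum_apply]
      exact Finset.sum_eq_zero fun i _ => h4 i _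
    have h6 : S *ᵥ x = 0 := by
      ext1 i
      rw [Pi.zero_apply, ← h5 (b i), hu, map_sum]
      simp only [Matrix.mulVec, dotProduct, map_smul, hSb, smul_eq_mul, mul_comm]
    exact (Matrix.mulVec_injective_iff_isUnit.mpr hS) (by rw [h6, Matrix.mulVec_zero])
  -- The sum telescopes to `X ^ deg d • G 1 - G d` plus the lower terms of `d` times `G 1`; since `G
  -- d = 0` this is `d • G 1`.
  · have hstep : ∀ k, pencil S T * ((X ^ k : ℂ[X]) • (S⁻¹ * G (divX^[k + 1] d)).map C) =
        (X ^ (k + 1) : ℂ[X]) • (G (divX^[k + 1] d)).map C - (X ^ k : ℂ[X]) • (G (divX^[k] d)).map C +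
          (C (d.coeff k) * X ^ k : ℂ[X]) • (G 1).map C := by
      intro k
      have e1 : S.map C * (S⁻¹ * G (divX^[k + 1] d)).map C = (G (divX^[k + 1] d)).map C := by
        rw [← Matrix.map_mul, ← Matrix.mul_assoc, Matrix.mul_nonsing_inv _ hSS, Matrix.one_mul]
      have e2 : T * (S⁻¹ * G (divX^[k + 1] d)) = G (divX^[k] d) - d.coeff k • G 1 := by
        rw [hTG, Function.iterate_succ_apply']
        have : X * divX (divX^[k] d) = divX^[k] d - C (d.coeff k) := by
          have := divX_mul_X_add (divX^[k] d)
          rw [coeff_divX_iterate, zero_add] at this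
          rw [mul_comm, eq_sub_iff_add_eq, this]
        rw [this]
        ext i j
        change h (b i) ((divX^[k] d - C (d.coeff k)) • e j) =
          h (b i) (divX^[k] d • e j) - d.coeff k • h (b i) ((1 : ℂ[X]) • e j)
        rw [sub_smul, map_sub, hCsmul, map_smul (h (b i)) (d.coeff k), one_smul]
      rw [pencil_eq, Matrix.sub_mul, Matrix.mul_smul, Matrix.mul_smul, Matrix.smul_mul, e1,
        ← Matrix.map_mul, e2, smul_smul, ← pow_succ]
      ext1 i j
      simp
      ring
    have hD : divX^[d.natDegree] d = 1 := by
      ext k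
      rw [coeff_divX_iterate, coeff_one]
      split_ifs with hk
      · rw [hk, zero_add]
        exact hd
      · exact coeff_eq_zero_of_natDegree_lt (by omega)
    have h0 : G d = 0 := by
      ext i j
      exact residueForm_smul_self hd _ _
    rw [Matrix.mul_sum, Finset.sum_congr rfl fun k _ => hstep k, Finset.sum_add_distrib,
      Finset.sum_range_sub (fun k => (X ^ k : ℂ[X]) • (G (divX^[k] d)).map C), hD, ← Finset.sum_smul]
    rw [Function.iterate_zero_apply, h0]
    conv_rhs => rw [hd.as_sum]
    rw [add_smul, Matrix.map_zero _ (map_zero C), smul_zero, sub_zero]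
  · rw [Matrix.mul_sum]
    ext1 i j
    rw [← sum_residueInf_divX_mul hd (hdeg i j), Matrix.sum_apply]
    refine Finset.sum_congr rfl fun k _ => ?_
    rw [Matrix.mul_smul, ← Matrix.map_mul, hBG, Matrix.smul_apply, Matrix.map_apply,
      Matrix.of_apply, smul_eq_mul, mul_comm]

end

/-! ### Hermitian state space on the real line -/

noncomputable section

variable {m : ℕ}

/-- A common denominator times its conjugate is real; division by a real monic polynomial commutes
with conjugation, so quotient and remainder inherit the symmetry. -/
theorem exists_hermitian_decomposition (G : Matrix (Fin m) (Fin m) (RatFunc ℂ))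
    (hG : ∀ i j, conjCoeff (G i j) = G j i) (hdeg : ∀ i j, (G i j).intDegree ≤ 1) :
    ∃ (d : ℂ[X]) (N : Matrix (Fin m) (Fin m) ℂ[X]) (D₁ D₀ : Matrix (Fin m) (Fin m) ℂ),
      d.Monic ∧ d.map (starRingEnd ℂ) = d ∧ (∀ i j, (N i j).map (starRingEnd ℂ) = N j i) ∧
      (∀ i j, (N i j).degree < d.degree) ∧ D₁ᴴ = D₁ ∧ D₀ᴴ = D₀ ∧
      ∀ i j, G i j = algebraMap _ _ (pencil D₁ D₀ i j) +
        algebraMap _ _ (N i j) / algebraMap _ _ d := by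
  set d₀ : ℂ[X] := ∏ i, ∏ j, (G i j).denom with hd₀
  have hm₀ : d₀.Monic := monic_prod_of_monic _ _ fun i _ =>
    monic_prod_of_monic _ _ fun j _ => RatFunc.monic_denom _
  set d : ℂ[X] := d₀ * d₀.map (starRingEnd ℂ) with hd
  have hm : d.Monic := hm₀.mul (hm₀.map _)
  have hcc : (starRingEnd ℂ).comp (starRingEnd ℂ) = RingHom.id ℂ := by ext; simp
  have hreal : d.map (starRingEnd ℂ) = d := by
    rw [hd, Polynomial.map_mul, Polynomial.map_map, hcc, Polynomial.map_id, mul_comm]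
  have hdvd : ∀ i j, ∃ p : ℂ[X], G i j = algebraMap _ _ p / algebraMap _ _ d := fun i j =>
    (RatFunc.denom_dvd hm.ne_zero).mp <|
      ((Finset.dvd_prod_of_mem (fun j => (G i j).denom) (Finset.mem_univ j)).trans
        (Finset.dvd_prod_of_mem (fun i => ∏ j, (G i j).denom) (Finset.mem_univ i))).trans
          (dvd_mul_right _ _)
  choose P hP using hdvd
  have hd0 : algebraMap ℂ[X] (RatFunc ℂ) d ≠ 0 := RatFunc.algebraMap_ne_zero hm.ne_zero
  have hPconj : ∀ i j, (P i j).map (starRingEnd ℂ) = P j i := by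
    intro i j
    have h := hG i j
    rw [hP, hP, map_div₀, conjCoeff_algebraMap, conjCoeff_algebraMap, hreal,
      div_left_inj' hd0] at h
    exact RatFunc.algebraMap_injective ℂ h
  have hPdeg : ∀ i j, (P i j /ₘ d).natDegree ≤ 1 := by
    intro i j
    rw [natDegree_divByMonic _ hm]
    by_cases h0 : P i j = 0
    · simp [h0]
    · have h := hdeg i j
      rw [hP, RatFunc.intDegree_div (RatFunc.algebraMap_ne_zero h0) hd0,
        RatFunc.intDegree_polynomial, RatFunc.intDegree_polynomial] at h
      omega
  have hQconj : ∀ i j, (P i j /ₘ d).map (starRingEnd ℂ) = P j i /ₘ d := by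
    intro i j
    rw [map_divByMonic _ hm, hPconj, hreal]
  have hcoeff : ∀ i j k, starRingEnd ℂ ((P i j /ₘ d).coeff k) = (P j i /ₘ d).coeff k := by
    intro i j k
    rw [← hQconj i j, coeff_map]
  refine ⟨d, Matrix.of fun i j => P i j %ₘ d, Matrix.of fun i j => (P i j /ₘ d).coeff 1,
    Matrix.of fun i j => -(P i j /ₘ d).coeff 0, hm, hreal, ?_, ?_, ?_, ?_, ?_⟩
  · intro i j
    rw [Matrix.of_apply, Matrix.of_apply, map_modByMonic _ hm, hPconj, hreal]
  · intro i j
    exact degree_modByMonic_lt _ hm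
  · ext i j
    exact hcoeff j i 1
  · ext i j
    rw [Matrix.conjTranspose_apply, Matrix.of_apply, star_neg]
    exact congrArg Neg.neg (hcoeff j i 0)
  · intro i j
    have hq : pencil (Matrix.of fun i j => (P i j /ₘ d).coeff 1)
        (Matrix.of fun i j => -(P i j /ₘ d).coeff 0) i j = P i j /ₘ d := by
      conv_rhs => rw [eq_X_add_C_of_natDegree_le_one (hPdeg i j)]
      rw [pencil_eq, mul_comm]
      simp
    rw [hq, hP]
    conv_lhs => rw [← modByMonic_add_div (P i j) d]
    rw [map_add, map_mul, Matrix.of_apply]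
    field_simp
    ring

/-- Keeping `Z` as the solution of a linear equation, instead of an inverse, lets a substitution be
applied entrywise later. -/
theorem exists_hermitian_state_space (G : Matrix (Fin m) (Fin m) (RatFunc ℂ))
    (hG : ∀ i j, conjCoeff (G i j) = G j i) (hdeg : ∀ i j, (G i j).intDegree ≤ 1) :
    ∃ (n : ℕ) (S T : Matrix (Fin n) (Fin n) ℂ) (B : Matrix (Fin n) (Fin m) ℂ)
      (D₁ D₀ : Matrix (Fin m) (Fin m) ℂ) (Z : Matrix (Fin n) (Fin m) (RatFunc ℂ)),
      Sᴴ = S ∧ Tᴴ = T ∧ D₁ᴴ = D₁ ∧ D₀ᴴ = D₀ ∧ IsUnit S ∧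
      (∀ (a : ℂ) (x : Fin n → ℂ), (a • S - T) *ᵥ x = 0 → Bᴴ *ᵥ x = 0 → x = 0) ∧
      ((RatFunc.X : RatFunc ℂ) • S.map RatFunc.C - T.map RatFunc.C) * Z = B.map RatFunc.C ∧
      (RatFunc.X : RatFunc ℂ) • D₁.map RatFunc.C - D₀.map RatFunc.C + Bᴴ.map RatFunc.C * Z =
        G := by
  obtain ⟨d, N, D₁, D₀, hm, hreal, hN, hNd, hD₁, hD₀, hGN⟩ :=
    exists_hermitian_decomposition G hG hdeg
  obtain ⟨n, S, T, B, Y, hS, hT, hSu, hobs, h1, h2⟩ := exists_hermitian_realization hm hreal hN hNd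
  set ι := algebraMap ℂ[X] (RatFunc ℂ) with hι
  have hd0 : ι d ≠ 0 := RatFunc.algebraMap_ne_zero hm.ne_zero
  have hC {p q : Type} (M : Matrix p q ℂ) : (M.map C).map ι = M.map RatFunc.C := by
    ext1 i j
    simp [hι]
  have hpencil {p q : Type} (M₁ M₀ : Matrix p q ℂ) :
      (pencil M₁ M₀).map ι =
        (RatFunc.X : RatFunc ℂ) • M₁.map RatFunc.C - M₀.map RatFunc.C := by
    ext1 i j
    simp [hι, pencil]
    ring
  refine ⟨n, S, T, B, D₁, D₀, (ι d)⁻¹ • Y.map ι, hS, hT, hD₁, hD₀, hSu, hobs, ?_, ?_⟩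
  · rw [← hpencil, Matrix.mul_smul, ← Matrix.map_mul, h1]
    ext1 i j
    simp only [Matrix.smul_apply, Matrix.map_apply, smul_eq_mul, map_mul, inv_mul_cancel_left₀ hd0]
    simp [hι]
  · rw [← hpencil, Matrix.mul_smul, ← hC, ← Matrix.map_mul, h2]
    ext1 i j
    rw [hGN]
    simp [div_eq_inv_mul, hι]

end

/-! ### Möbius substitutions between line and circle -/

noncomputable section

/-- The substitution `q(X) ↦ q(t)` for a transcendental element `t` of `ℂ(X)`. -/
def substHom (t : RatFunc ℂ) (ht : Transcendental ℂ t) : RatFunc ℂ →+* RatFunc ℂ :=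
  RatFunc.liftRingHom (Polynomial.aeval (R := ℂ) t).toRingHom
    (nonZeroDivisors_le_comap_nonZeroDivisors_of_injective _ (transcendental_iff_injective.mp ht))

section substHom

variable (t : RatFunc ℂ) (ht : Transcendental ℂ t)

theorem substHom_algebraMap (p : ℂ[X]) : substHom t ht (algebraMap _ _ p) = aeval t p :=
  RatFunc.liftRingHom_algebraMap (Polynomial.aeval (R := ℂ) t).toRingHom _ p

@[simp] theorem substHom_C (a : ℂ) : substHom t ht (RatFunc.C a) = RatFunc.C a := by
  simpa using substHom_algebraMap t ht (Polynomial.C a)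

@[simp] theorem substHom_X : substHom t ht RatFunc.X = t := by
  simpa using substHom_algebraMap t ht Polynomial.X

end substHom

theorem RatFunc.X_sub_C_ne_zero (a : ℂ) : (RatFunc.X - RatFunc.C a : RatFunc ℂ) ≠ 0 := by
  have := RatFunc.algebraMap_ne_zero (Polynomial.X_sub_C_ne_zero a)
  simpa using this

/-- The Möbius transformation `w (X + i) / (X - i)` taking the real line to the circle `|z| = |w|`
and `∞` to `w`. -/
def toCircle (w : ℂ) : RatFunc ℂ :=
  RatFunc.C w * (RatFunc.X + RatFunc.C Complex.I) / (RatFunc.X - RatFunc.C Complex.I)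

/-- The Möbius transformation `i (X + w) / (X - w)`, inverse to `toCircle w`. -/
def toLine (w : ℂ) : RatFunc ℂ :=
  RatFunc.C Complex.I * (RatFunc.X + RatFunc.C w) / (RatFunc.X - RatFunc.C w)

theorem RatFunc.C_I_mul_self : (RatFunc.C Complex.I * RatFunc.C Complex.I : RatFunc ℂ) = -1 := by
  rw [← map_mul, Complex.I_mul_I, map_neg, map_one]

theorem toLine_relation {w : ℂ} (hw : w ≠ 0) :
    RatFunc.C w * (toLine w + RatFunc.C Complex.I) / (toLine w - RatFunc.C Complex.I) =
      (RatFunc.X : RatFunc ℂ) := by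
  have h1 := RatFunc.X_sub_C_ne_zero w
  have hI : (RatFunc.C Complex.I : RatFunc ℂ) ≠ 0 := by simp
  have hw' : (RatFunc.C w : RatFunc ℂ) ≠ 0 := by simpa using hw
  have e1 : toLine w + RatFunc.C Complex.I =
      2 * RatFunc.C Complex.I * RatFunc.X / (RatFunc.X - RatFunc.C w) := by
    unfold toLine; field_simp; ring
  have e2 : toLine w - RatFunc.C Complex.I =
      2 * RatFunc.C Complex.I * RatFunc.C w / (RatFunc.X - RatFunc.C w) := by
    unfold toLine; field_simp; ring
  rw [e1, e2]
  field_simp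

theorem toCircle_relation {w : ℂ} (hw : w ≠ 0) :
    RatFunc.C Complex.I * (toCircle w + RatFunc.C w) / (toCircle w - RatFunc.C w) =
      (RatFunc.X : RatFunc ℂ) := by
  have h1 := RatFunc.X_sub_C_ne_zero Complex.I
  have hI : (RatFunc.C Complex.I : RatFunc ℂ) ≠ 0 := by simp
  have hw' : (RatFunc.C w : RatFunc ℂ) ≠ 0 := by simpa using hw
  have e1 : toCircle w + RatFunc.C w =
      2 * RatFunc.C w * RatFunc.X / (RatFunc.X - RatFunc.C Complex.I) := by
    unfold toCircle; field_simp; ring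
  have e2 : toCircle w - RatFunc.C w =
      2 * RatFunc.C Complex.I * RatFunc.C w / (RatFunc.X - RatFunc.C Complex.I) := by
    unfold toCircle; field_simp; ring
  rw [e1, e2]
  field_simp

theorem isAlgebraic_mobius {t : RatFunc ℂ} (ht : IsAlgebraic ℂ t) (a b : ℂ) :
    IsAlgebraic ℂ (RatFunc.C a * (t + RatFunc.C b) / (t - RatFunc.C b)) := by
  have hC : ∀ c, IsAlgebraic ℂ (RatFunc.C c : RatFunc ℂ) := fun c => by
    rw [← RatFunc.algebraMap_eq_C]
    exact isAlgebraic_algebraMap c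
  rw [div_eq_mul_inv]
  exact ((hC a).mul (ht.add (hC b))).mul (ht.sub (hC b)).inv

/-- `X` is a Möbius image of `toLine w`, so it would be algebraic too. -/
theorem transcendental_toLine {w : ℂ} (hw : w ≠ 0) : Transcendental ℂ (toLine w) := fun h =>
  RatFunc.transcendental_X (K := ℂ) (toLine_relation hw ▸ isAlgebraic_mobius h w Complex.I)

theorem transcendental_toCircle {w : ℂ} (hw : w ≠ 0) : Transcendental ℂ (toCircle w) := fun h =>
  RatFunc.transcendental_X (K := ℂ) (toCircle_relation hw ▸ isAlgebraic_mobius h Complex.I w)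

theorem substHom_toLine_toCircle {w : ℂ} (hw : w ≠ 0) (q : RatFunc ℂ) :
    substHom _ (transcendental_toLine hw) (substHom _ (transcendental_toCircle hw) q) = q := by
  have : (substHom _ (transcendental_toLine hw)).comp (substHom _ (transcendental_toCircle hw)) =
      RingHom.id _ := by
    refine ratFunc_ringHom_ext (by simp) ?_
    rw [RingHom.comp_apply, substHom_X]
    conv_lhs => enter [2]; unfold toCircle
    simpa using toLine_relation hw
  exact congrArg (fun f => f q) this

/-- It suffices to compare on `X`: conjugating `w (X + i) / (X - i)` inverts it, because `w * conj w
= 1`. -/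
theorem conjCoeff_substHom_toCircle {w : ℂ} (hw : w ≠ 0) (hw1 : w * starRingEnd ℂ w = 1)
    (q : RatFunc ℂ) :
    conjCoeff (substHom _ (transcendental_toCircle hw) q) =
      substHom _ (transcendental_toCircle hw) (circleConj q) := by
  have : conjCoeff.comp (substHom _ (transcendental_toCircle hw)) =
      (substHom _ (transcendental_toCircle hw)).comp circleConj := by
    refine ratFunc_ringHom_ext (by simp) ?_
    have hwc : (RatFunc.C w : RatFunc ℂ) * RatFunc.C (starRingEnd ℂ w) = 1 := by
      rw [← map_mul, hw1, map_one]
    rw [RingHom.comp_apply, RingHom.comp_apply, substHom_X, circleConj_X, map_inv₀, substHom_X]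
    simp only [toCircle, map_div₀, map_mul, map_add, map_sub, conjCoeff_C, conjCoeff_X,
      Complex.conj_I, map_neg, inv_div]
    rw [eq_inv_of_mul_eq_one_right hwc, sub_neg_eq_add, ← sub_eq_add_neg, inv_mul_eq_div, div_div]
  exact congrArg (fun f => f q) this

section Valuation

open Classical RatFunc

theorem inftyValuation_C_le (a : ℂ) : inftyValuation ℂ (RatFunc.C a) ≤ 1 := by
  by_cases h : a = 0
  · simp [h]
  · rw [inftyValuation.C ℂ h]

theorem inftyValuation_aeval_le {t : RatFunc ℂ} (ht : inftyValuation ℂ t ≤ 1) (p : ℂ[X]) :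
    inftyValuation ℂ (aeval t p) ≤ 1 := by
  induction p using Polynomial.induction_on' with
  | add p q hp hq =>
    rw [map_add]
    exact (Valuation.map_add _ _ _).trans (max_le hp hq)
  | monomial k c =>
    rw [aeval_monomial, map_mul, map_pow, RatFunc.algebraMap_eq_C]
    exact mul_le_one' (inftyValuation_C_le c) (pow_le_one' ht k)

theorem inftyValuation_X_sub_C (a : ℂ) :
    inftyValuation ℂ (RatFunc.X - RatFunc.C a) = WithZero.exp 1 := by
  have h := inftyValuation.polynomial ℂ (Polynomial.X_sub_C_ne_zero a)
  rw [natDegree_X_sub_C] at h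
  simpa [inftyValuation_apply] using h

theorem toCircle_sub_C (w : ℂ) : toCircle w - RatFunc.C w =
    RatFunc.C (2 * Complex.I * w) / (RatFunc.X - RatFunc.C Complex.I) := by
  have h1 := RatFunc.X_sub_C_ne_zero Complex.I
  unfold toCircle
  field_simp
  simp only [map_mul, map_ofNat]
  ring

theorem inftyValuation_toCircle_sub_lt (w : ℂ) :
    inftyValuation ℂ (toCircle w - RatFunc.C w) < 1 := by
  rw [toCircle_sub_C, map_div₀, inftyValuation_X_sub_C]
  refine (div_le_div_of_nonneg_right (inftyValuation_C_le _) zero_le).trans_lt ?_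
  rw [one_div, ← WithZero.exp_neg, ← WithZero.exp_zero]
  exact WithZero.exp_lt_exp.mpr (by norm_num)

theorem inftyValuation_toCircle_le (w : ℂ) : inftyValuation ℂ (toCircle w) ≤ 1 := by
  have : toCircle w = (toCircle w - RatFunc.C w) + RatFunc.C w := by ring
  rw [this]
  exact (Valuation.map_add _ _ _).trans
    (max_le (inftyValuation_toCircle_sub_lt w).le (inftyValuation_C_le w))

/-- Since `toCircle w` tends to `w` at infinity, `p (toCircle w)` tends to `p w`. -/
theorem inftyValuation_aeval_toCircle_eq_one {w : ℂ} {p : ℂ[X]} (hp : p.eval w ≠ 0) :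
    inftyValuation ℂ (aeval (toCircle w) p) = 1 := by
  obtain ⟨r, hr⟩ := Polynomial.X_sub_C_dvd_sub_C_eval (a := w) (p := p)
  have e : aeval (toCircle w) p =
      (toCircle w - RatFunc.C w) * aeval (toCircle w) r + RatFunc.C (p.eval w) := by
    have h := congrArg (aeval (toCircle w)) hr
    simp only [map_sub, map_mul, aeval_X, aeval_C, RatFunc.algebraMap_eq_C] at h
    rw [← h]
    ring
  have h1 : inftyValuation ℂ ((toCircle w - RatFunc.C w) * aeval (toCircle w) r) <
      inftyValuation ℂ (RatFunc.C (p.eval w)) := by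
    rw [inftyValuation.C ℂ hp, map_mul]
    exact (mul_le_of_le_one_right' (inftyValuation_aeval_le (inftyValuation_toCircle_le w) r)).trans_lt
      (inftyValuation_toCircle_sub_lt w)
  rw [e, Valuation.map_add_eq_of_lt_right _ h1, inftyValuation.C ℂ hp]

theorem inftyValuation_substHom_toCircle_le {w : ℂ} (hw : w ≠ 0) {q : RatFunc ℂ}
    (hq : q.denom.eval w ≠ 0) :
    inftyValuation ℂ (substHom _ (transcendental_toCircle hw) q) ≤ 1 := by
  conv_lhs => rw [← RatFunc.num_div_denom q]
  rw [map_div₀, substHom_algebraMap, substHom_algebraMap, map_div₀,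
    inftyValuation_aeval_toCircle_eq_one hq, div_one]
  exact inftyValuation_aeval_le (inftyValuation_toCircle_le w) _

theorem intDegree_le_one_of_inftyValuation_le {q : RatFunc ℂ}
    (hq : inftyValuation ℂ q ≤ WithZero.exp 1) : q.intDegree ≤ 1 := by
  by_cases h : q = 0
  · simp [h]
  · rw [inftyValuation_apply, inftyValuation_of_nonzero ℂ h] at hq
    simpa using hq

end Valuation

/-- The unit circle is infinite, so it cannot lie in the root set of `p(X²)`. A square root `v` of
`w` is needed to make the linear factor vanishing at `w` palindromic. -/
theorem exists_unit_sq_eval_ne_zero {p : ℂ[X]} (hp : p ≠ 0) :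
    ∃ v : ℂ, v * starRingEnd ℂ v = 1 ∧ p.eval (v * v) ≠ 0 := by
  have hinf : (Metric.sphere (0 : ℂ) 1).Infinite := by
    refine IsPreconnected.infinite_of_nontrivial ?_ ⟨1, by simp, -1, by simp, ?_⟩
    · exact (isPreconnected_sphere (by simp [Complex.rank_real_complex]) _ _)
    · intro h
      have := congrArg Complex.re h
      norm_num at this
  have hc : p.comp (X * X) ≠ 0 := by
    intro h
    rcases Polynomial.comp_eq_zero_iff.mp h with h | ⟨-, h⟩
    · exact hp h
    · have := congrArg (fun q => coeff q 2) h
      simp [← pow_two] at this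
  have hroots : {x | (p.comp (X * X)).IsRoot x}.Finite := Polynomial.finite_setOfPred_isRoot hc
  obtain ⟨v, hv, hv'⟩ := hinf.exists_notMem_finite hroots
  refine ⟨v, ?_, ?_⟩
  · rw [Complex.mul_conj, Complex.normSq_eq_norm_sq, mem_sphere_zero_iff_norm.mp hv]
    simp
  · simpa [IsRoot] using hv'

end

/-! ### Construction of the palindromic linearization -/

noncomputable section

variable {n m : ℕ}

theorem natDegree_pencil_le {ι κ : Type*} (M₁ M₀ : Matrix ι κ ℂ) (i : ι) (j : κ) :
    (pencil M₁ M₀ i j).natDegree ≤ 1 := by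
  simp only [pencil, Matrix.of_apply]
  compute_degree

theorem reflect_pencil {ι κ : Type*} (M₁ M₀ : Matrix ι κ ℂ) (i : ι) (j : κ) :
    ((pencil M₁ M₀ i j).map (starRingEnd ℂ)).reflect 1 = pencil (-M₀ᴴ) (-M₁ᴴ) j i := by
  simp [pencil, mul_comm X, Polynomial.reflect_sub, Polynomial.reflect_C,
    Polynomial.reflect_C_mul, Polynomial.reflect_one_X]
  ring

theorem map_algebraMap_pencil {ι κ : Type*} (M₁ M₀ : Matrix ι κ ℂ) :
    (pencil M₁ M₀).map (algebraMap ℂ[X] (RatFunc ℂ)) =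
      (RatFunc.X : RatFunc ℂ) • M₁.map RatFunc.C - M₀.map RatFunc.C := by
  ext1 i j
  simp [pencil]
  ring

/-- For `b ≠ 0` this is observability at `a / b`; for `b = 0`, invertibility of `S` is enough. -/
theorem rank_fromRows_eq_of_observable {S T : Matrix (Fin n) (Fin n) ℂ} {B : Matrix (Fin n) (Fin m) ℂ}
    (hS : IsUnit S)
    (hobs : ∀ (a : ℂ) (x : Fin n → ℂ), (a • S - T) *ᵥ x = 0 → Bᴴ *ᵥ x = 0 → x = 0)
    {a b : ℂ} (hab : a ≠ 0 ∨ b ≠ 0) :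
    (Matrix.fromRows (-(a • S - b • T)) (b • Bᴴ)).rank = n := by
  have hinj : Function.Injective (Matrix.fromRows (-(a • S - b • T)) (b • Bᴴ)).mulVec := by
    rw [← Matrix.coe_mulVecLin, ← LinearMap.ker_eq_bot, LinearMap.ker_eq_bot']
    intro x hx
    rw [Matrix.mulVecLin_apply, Matrix.fromRows_mulVec] at hx
    have h1 : (a • S - b • T) *ᵥ x = 0 := by
      rw [← neg_eq_zero, ← Matrix.neg_mulVec]
      exact funext fun i => congrFun hx (Sum.inl i)
    have h2 : (b • Bᴴ) *ᵥ x = 0 := funext fun i => congrFun hx (Sum.inr i)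
    by_cases hb : b = 0
    · have ha : a ≠ 0 := by tauto
      rw [hb, zero_smul, sub_zero, Matrix.smul_mulVec, smul_eq_zero_iff_right ha] at h1
      exact (Matrix.mulVec_injective_iff_isUnit.mpr hS) (by rw [h1, Matrix.mulVec_zero])
    · rw [Matrix.smul_mulVec, smul_eq_zero_iff_right hb] at h2
      refine hobs (b⁻¹ * a) x ?_ h2
      have : (b⁻¹ * a) • S - T = b⁻¹ • (a • S - b • T) := by
        rw [smul_sub, smul_smul, smul_smul, inv_mul_cancel₀ hb, one_smul]
      rw [this, Matrix.smul_mulVec, h1, smul_zero]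
  rw [Matrix.rank, LinearMap.finrank_range_of_inj hinj]
  simp

open scoped ComplexOrder in
theorem rank_fromCols_eq_of_observable {S T : Matrix (Fin n) (Fin n) ℂ} {B : Matrix (Fin n) (Fin m) ℂ}
    (hS : IsUnit S) (hSh : Sᴴ = S) (hTh : Tᴴ = T)
    (hobs : ∀ (a : ℂ) (x : Fin n → ℂ), (a • S - T) *ᵥ x = 0 → Bᴴ *ᵥ x = 0 → x = 0)
    {a b : ℂ} (hab : a ≠ 0 ∨ b ≠ 0) :
    (Matrix.fromCols (-(a • S - b • T)) (b • B)).rank = n := by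
  rw [← Matrix.rank_conjTranspose, Matrix.conjTranspose_fromCols_eq_fromRows_conjTranspose]
  simp only [Matrix.conjTranspose_neg, Matrix.conjTranspose_sub, Matrix.conjTranspose_smul, hSh,
    hTh]
  exact rank_fromRows_eq_of_observable hS hobs (by simpa using hab)

/-- The pencil `c (λ S - T)`, with `c = i (conj v t - v)` and `c λ = -(conj v t + v)`. -/
def circlePencil {ι κ : Type*} (v : ℂ) (S T : Matrix ι κ ℂ) : Matrix ι κ ℂ[X] :=
  pencil (-starRingEnd ℂ v • (S + Complex.I • T)) (v • (S - Complex.I • T))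

theorem circlePencil_eval {ι κ : Type*} (v t : ℂ) (S T : Matrix ι κ ℂ) :
    (circlePencil v S T).map (eval t) =
      (-(starRingEnd ℂ v * t + v)) • S - (Complex.I * (starRingEnd ℂ v * t - v)) • T := by
  ext1 i j
  simp [circlePencil, pencil]
  ring

/-- The scalar equals `i conj v (X - v²)`, so it cancels the pole of `toLine (v * v)`. -/
theorem mul_toLine {v : ℂ} (hv : v * starRingEnd ℂ v = 1) :
    (RatFunc.C Complex.I * (RatFunc.C (starRingEnd ℂ v) * RatFunc.X - RatFunc.C v)) *
      toLine (v * v) = -(RatFunc.C (starRingEnd ℂ v) * RatFunc.X + RatFunc.C v) := by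
  have h1 := RatFunc.X_sub_C_ne_zero (v * v)
  have hvc : (RatFunc.C v : RatFunc ℂ) * RatFunc.C (starRingEnd ℂ v) = 1 := by
    rw [← map_mul, hv, map_one]
  have hI := RatFunc.C_I_mul_self
  unfold toLine
  rw [mul_div_assoc', div_eq_iff h1]
  simp only [map_mul]
  generalize (RatFunc.C v : RatFunc ℂ) = a at *
  generalize (RatFunc.C (starRingEnd ℂ v) : RatFunc ℂ) = b at *
  linear_combination (b * RatFunc.X - a) * (RatFunc.X + a * a) * hI -
    2 * a * RatFunc.X * hvc

theorem circlePencil_map {ι κ : Type*} {v : ℂ} (hv : v * starRingEnd ℂ v = 1)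
    (S T : Matrix ι κ ℂ) :
    (circlePencil v S T).map (algebraMap ℂ[X] (RatFunc ℂ)) =
      (RatFunc.C Complex.I * (RatFunc.C (starRingEnd ℂ v) * RatFunc.X - RatFunc.C v)) •
        (toLine (v * v) • S.map RatFunc.C - T.map RatFunc.C) := by
  rw [smul_sub, smul_smul, mul_toLine hv, circlePencil, map_algebraMap_pencil]
  ext1 i j
  simp
  ring

theorem exists_isStarPalindromic_linearization (H : Matrix (Fin m) (Fin m) (RatFunc ℂ))
    (hH : (RatFunc.X : RatFunc ℂ) • H.transpose.map circleConj = H) :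
    ∃ (n : ℕ) (L : LinearSystemMatrix n m),
      L.IsStronglyMinimalLinearization H ∧ IsStarPalindromic 1 L.toMatrix := by
  obtain ⟨v, hv, hpole⟩ := exists_unit_sq_eval_ne_zero
    (p := ∏ i, ∏ j, (H i j).denom)
    (Finset.prod_ne_zero_iff.mpr fun i _ => Finset.prod_ne_zero_iff.mpr fun j _ =>
      RatFunc.denom_ne_zero _)
  have hpole' : ∀ i j, (H i j).denom.eval (v * v) ≠ 0 := by
    intro i j
    rw [eval_prod, Finset.prod_ne_zero_iff] at hpole
    have := hpole i (Finset.mem_univ i)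
    rw [eval_prod, Finset.prod_ne_zero_iff] at this
    exact this j (Finset.mem_univ j)
  have hv0 : v ≠ 0 := left_ne_zero_of_mul_eq_one hv
  have hvs0 : starRingEnd ℂ v ≠ 0 := right_ne_zero_of_mul_eq_one hv
  have hw : v * v ≠ 0 := mul_ne_zero hv0 hv0
  have hw1 : v * v * starRingEnd ℂ (v * v) = 1 := by
    rw [map_mul]
    linear_combination (v * starRingEnd ℂ v + 1) * hv
  have hvc : (RatFunc.C v : RatFunc ℂ) * RatFunc.C (starRingEnd ℂ v) = 1 := by
    rw [← map_mul, hv, map_one]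
  obtain ⟨c, hc⟩ : ∃ c : RatFunc ℂ, c =
    RatFunc.C Complex.I * (RatFunc.C (starRingEnd ℂ v) * RatFunc.X - RatFunc.C v) := ⟨_, rfl⟩
  have hcX : c = RatFunc.C (Complex.I * starRingEnd ℂ v) * (RatFunc.X - RatFunc.C (v * v)) := by
    rw [hc]
    simp only [map_mul]
    linear_combination RatFunc.C Complex.I * RatFunc.C v * hvc
  have hc0 : c ≠ 0 := by
    rw [hcX]
    exact mul_ne_zero (by simpa using hv0) (RatFunc.X_sub_C_ne_zero _)
  -- As `c` has the same symmetry as `H`, the quotient `H / c` is Hermitian for `circleConj`.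
  have hcc : RatFunc.X * circleConj c = c := by
    have hX : (RatFunc.X : RatFunc ℂ) ≠ 0 := RatFunc.X_ne_zero
    rw [hc]
    simp only [map_mul, map_sub, circleConj_C, circleConj_X, Complex.conj_conj, Complex.conj_I,
      map_neg]
    field_simp
    ring
  set τ := substHom _ (transcendental_toCircle hw) with hτ
  set σ := substHom _ (transcendental_toLine hw) with hσ
  have hστ : ∀ q, σ (τ q) = q := substHom_toLine_toCircle hw
  -- Dividing by `c` costs exactly one degree at infinity, where `τ` of each entry of `H` is
  -- bounded.
  have hτc : (τ c)⁻¹ = RatFunc.C (-(2 * v))⁻¹ * (RatFunc.X - RatFunc.C Complex.I) := by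
    have h1 := RatFunc.X_sub_C_ne_zero Complex.I
    have h2 : τ c = RatFunc.C (-(2 * v)) / (RatFunc.X - RatFunc.C Complex.I) := by
      rw [hcX, map_mul, hτ, substHom_C, map_sub, substHom_X, substHom_C, toCircle_sub_C,
        mul_div_assoc', ← map_mul]
      congr 2
      linear_combination 2 * v * (Complex.I * Complex.I) * hv + 2 * v * Complex.I_mul_I
    rw [h2, inv_div, map_inv₀, div_eq_inv_mul]
  obtain ⟨n, S, T, B, D₁, D₀, Z, hS, hT, hD₁, hD₀, hSu, hobs, hZ1, hZ2⟩ :=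
    exists_hermitian_state_space (Matrix.of fun i j => τ (H i j / c))
      (fun i j => by
        have hij : H j i = RatFunc.X * circleConj (H i j) := congrFun (congrFun hH.symm j) i
        rw [Matrix.of_apply, Matrix.of_apply, conjCoeff_substHom_toCircle hw hw1, hij, map_div₀,
          ← hτ]
        congr 1
        conv_rhs => rw [← hcc]
        rw [mul_div_mul_left _ _ RatFunc.X_ne_zero])
      (fun i j => by
        refine intDegree_le_one_of_inftyValuation_le ?_
        rw [Matrix.of_apply, map_div₀, div_eq_mul_inv, hτc, map_mul, map_mul,
          inftyValuation_X_sub_C]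
        refine mul_le_of_le_one_of_le
          (inftyValuation_substHom_toCircle_le hw (hpole' i j)) ?_
        exact mul_le_of_le_one_of_le (inftyValuation_C_le _) le_rfl)
  have hσZ1 : (toLine (v * v) • S.map RatFunc.C - T.map RatFunc.C) * Z.map σ =
      B.map RatFunc.C := by
    have h := congrArg (fun M => M.map σ) hZ1
    simp only [Matrix.map_mul] at h
    convert h using 1
    · congr 1
      ext1 i j
      simp [hσ]
    · ext1 i j
      simp [hσ]
  have hσZ2 : toLine (v * v) • D₁.map RatFunc.C - D₀.map RatFunc.C +
      Bᴴ.map RatFunc.C * Z.map σ = c⁻¹ • H := by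
    have h := congrArg (fun M => M.map σ) hZ2
    rw [Matrix.map_add _ (map_add σ), Matrix.map_mul] at h
    convert h using 1
    · congr 1
      · ext1 i j
        simp [hσ]
      · congr 1
        ext1 i j
        simp [hσ]
    · ext1 i j
      rw [Matrix.map_apply, Matrix.of_apply, hστ, Matrix.smul_apply, smul_eq_mul, div_eq_inv_mul]
  -- At `z = v²` the coefficient of `T` vanishes and the pencil becomes `-2 v S`.
  have hreg : (circlePencil v S T).det ≠ 0 := by
    intro h0
    have h := congrArg (eval (v * v)) h0
    rw [← Polynomial.coe_evalRingHom, RingHom.map_det, RingHom.mapMatrix_apply,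
      Polynomial.coe_evalRingHom, circlePencil_eval] at h
    have e1 : starRingEnd ℂ v * (v * v) = v := by linear_combination v * hv
    rw [e1, sub_self, mul_zero, zero_smul, sub_zero, Matrix.det_smul, eval_zero, mul_eq_zero] at h
    rcases h with h | h
    · refine pow_ne_zero _ ?_ h
      rw [← two_mul]
      simpa using hv0
    · exact ((Matrix.isUnit_iff_isUnit_det _).mp hSu).ne_zero h
  -- The blocks are `c (λ S - T)`, `c B`, `c B*` and `c (λ D₁ - D₀)` with `λ = toLine (v * v)`. The
  -- constant matrix `B` enters as `λ 0 - (-B)`, hence the zeros and signs.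
  let L : LinearSystemMatrix n m :=
    { A₁ := -starRingEnd ℂ v • (S + Complex.I • T)
      A₀ := v • (S - Complex.I • T)
      B₁ := -starRingEnd ℂ v • (0 + Complex.I • -B)
      B₀ := v • (0 - Complex.I • -B)
      C₁ := -starRingEnd ℂ v • (0 + Complex.I • -Bᴴ)
      C₀ := v • (0 - Complex.I • -Bᴴ)
      D₁ := -starRingEnd ℂ v • (D₁ + Complex.I • D₀)
      D₀ := v • (D₁ - Complex.I • D₀)
      regular := hreg }
  have hne : ∀ t, -(starRingEnd ℂ v * t + v) ≠ 0 ∨ Complex.I * (starRingEnd ℂ v * t - v) ≠ 0 := by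
    intro t
    by_contra! h
    have h2 : starRingEnd ℂ v * t - v = 0 := by simpa using h.2
    exact hv0 (by linear_combination (-h.1 - h2) / 2)
  refine ⟨n, L, ⟨⟨fun t => ?_, ?_⟩, ?_⟩, ?_, ?_⟩
  · have hA := circlePencil_eval v t S T
    have hB := circlePencil_eval v t 0 (-B)
    have hC := circlePencil_eval v t 0 (-Bᴴ)
    rw [smul_zero, zero_sub, smul_neg, neg_neg] at hB hC
    constructor
    · refine Eq.trans ?_ (rank_fromCols_eq_of_observable hSu hS hT hobs (hne t))
      rw [← hA, ← hB]
      congr 1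
      ext i j
      rcases j with j | j <;> simp [circlePencil, L]
    · refine Eq.trans ?_ (rank_fromRows_eq_of_observable hSu hobs (hne t))
      rw [← hA, ← hC]
      congr 1
      ext i j
      rcases i with i | i <;> simp [circlePencil, L]
  -- The leading coefficients form the combination with `a = -conj v` and `b = i conj v`.
  · have hab : -starRingEnd ℂ v ≠ 0 ∨ Complex.I * starRingEnd ℂ v ≠ 0 := Or.inl (neg_ne_zero.mpr hvs0)
    constructor
    · refine Eq.trans ?_ (rank_fromCols_eq_of_observable hSu hS hT hobs hab)
      congr 1
      ext i j
      rcases j with j | j <;> simp [L] <;> ring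
    · refine Eq.trans ?_ (rank_fromRows_eq_of_observable hSu hobs hab)
      congr 1
      ext i j
      rcases i with i | i <;> simp [L] <;> ring
  · have hA := circlePencil_map hv S T
    have hB := circlePencil_map hv 0 (-B)
    have hC := circlePencil_map hv 0 (-Bᴴ)
    have hD := circlePencil_map hv D₁ D₀
    rw [← hc] at hA hB hC hD
    have hAinv : ((circlePencil v S T).map (algebraMap ℂ[X] (RatFunc ℂ)))⁻¹ *
        (circlePencil v 0 (-B)).map (algebraMap ℂ[X] (RatFunc ℂ)) = Z.map σ := by
      have h1 : (circlePencil v 0 (-B)).map (algebraMap ℂ[X] (RatFunc ℂ)) =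
          (circlePencil v S T).map (algebraMap ℂ[X] (RatFunc ℂ)) * Z.map σ := by
        rw [hA, hB, Matrix.smul_mul, hσZ1]
        ext1 i j
        simp
      have hdet : IsUnit ((circlePencil v S T).map (algebraMap ℂ[X] (RatFunc ℂ))).det :=
        L.isUnit_det_map
      rw [h1, ← Matrix.mul_assoc, Matrix.nonsing_inv_mul _ hdet, Matrix.one_mul]
    change (circlePencil v D₁ D₀).map (algebraMap ℂ[X] (RatFunc ℂ)) +
      (circlePencil v 0 (-Bᴴ)).map (algebraMap ℂ[X] (RatFunc ℂ)) *
        ((circlePencil v S T).map (algebraMap ℂ[X] (RatFunc ℂ)))⁻¹ *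
        (circlePencil v 0 (-B)).map (algebraMap ℂ[X] (RatFunc ℂ)) = H
    rw [Matrix.mul_assoc, hAinv, hC, hD]
    have h2 : toLine (v * v) • (0 : Matrix (Fin m) (Fin n) ℂ).map RatFunc.C -
        (-Bᴴ).map RatFunc.C = Bᴴ.map RatFunc.C := by
      ext1 i j
      simp
    rw [h2, Matrix.smul_mul, ← smul_add, hσZ2, smul_smul, mul_inv_cancel₀ hc0, one_smul]
  · rintro (i | i) (j | j)
    · simpa [LinearSystemMatrix.toMatrix] using natDegree_pencil_le _ _ i j
    · simpa [LinearSystemMatrix.toMatrix] using natDegree_pencil_le _ _ i j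
    · simpa [LinearSystemMatrix.toMatrix] using natDegree_pencil_le _ _ i j
    · simpa [LinearSystemMatrix.toMatrix] using natDegree_pencil_le _ _ i j
  -- Reversal exchanges the two coefficients of a circle pencil and replaces `S`, `T` by their
  -- adjoints.
  · have hstar {p q : Type} (S T : Matrix p q ℂ) :
        -(v • (S - Complex.I • T))ᴴ = -starRingEnd ℂ v • (Sᴴ + Complex.I • Tᴴ) ∧
        -(-starRingEnd ℂ v • (S + Complex.I • T))ᴴ = v • (Sᴴ - Complex.I • Tᴴ) := by
      constructor <;> ext i j <;> simp <;> ring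
    ext1 i j
    rw [revStar, Matrix.map_apply, Matrix.transpose_apply]
    rcases i with i | i <;> rcases j with j | j <;>
      simp only [LinearSystemMatrix.toMatrix, Matrix.fromBlocks_apply₁₁,
        Matrix.fromBlocks_apply₁₂, Matrix.fromBlocks_apply₂₁, Matrix.fromBlocks_apply₂₂,
        Matrix.neg_apply, Polynomial.map_neg, Polynomial.reflect_neg, reflect_pencil, L,
        hstar, hS, hT, hD₁, hD₀, Matrix.conjTranspose_neg, Matrix.conjTranspose_conjTranspose,
        Matrix.conjTranspose_zero]

theorem isParaHermitian_iff_exists_linearization (R : Matrix (Fin m) (Fin m) (RatFunc ℂ)) {α : ℂ}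
    (hα : α ≠ 0) :
    IsParaHermitian R ↔
      ∃ (n : ℕ) (L : LinearSystemMatrix n m),
        L.IsStronglyMinimalLinearization
          ((RatFunc.C α + RatFunc.C (starRingEnd ℂ α) * RatFunc.X) • R) ∧
        IsStarPalindromic 1 L.toMatrix := by
  rw [isParaHermitian_iff_smul R hα rfl]
  constructor
  · exact exists_isStarPalindromic_linearization _
  · rintro ⟨n, L, hL, hpal⟩
    rw [← hL.2]
    exact L.transferFunction_of_isStarPalindromic hpal

end

/-! ### Both equivalences -/

theorem mainTheorem2 (m : ℕ) (R : Matrix (Fin m) (Fin m) (RatFunc ℂ)) (α : ℂ) (hα : α ≠ 0) :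
    (IsParaHermitian R ↔
      ∃ (n : ℕ) (L : LinearSystemMatrix n m),
        L.IsStronglyMinimalLinearization
          ((RatFunc.C α + RatFunc.C (starRingEnd ℂ α) * RatFunc.X) • R) ∧
        IsStarPalindromic 1 L.toMatrix) ∧
    (IsParaSkewHermitian R ↔
      ∃ (n : ℕ) (L : LinearSystemMatrix n m),
        L.IsStronglyMinimalLinearization
          ((RatFunc.C α + RatFunc.C (starRingEnd ℂ α) * RatFunc.X) • R) ∧
        IsStarAntiPalindromic 1 L.toMatrix) := by
  refine ⟨isParaHermitian_iff_exists_linearization R hα, ?_⟩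
  -- A palindromic pencil for `i R` and an anti-palindromic one for `R` differ by the factor `i`.
  rw [isParaSkewHermitian_iff, isParaHermitian_iff_exists_linearization _ hα]
  constructor
  · rintro ⟨n, L, hL, hpal⟩
    refine ⟨n, L.smul (-Complex.I) (by simp), ?_, ?_⟩
    · have h := hL.smul (k := -Complex.I) (by simp)
      rwa [smul_comm _ (RatFunc.C Complex.I), smul_smul, ← map_mul, neg_mul, Complex.I_mul_I,
        neg_neg, map_one, one_smul] at h
    · rw [LinearSystemMatrix.smul_toMatrix]
      exact LinearSystemMatrix.isStarAntiPalindromic_smul_neg_I hpal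
  · rintro ⟨n, L, hL, hpal⟩
    refine ⟨n, L.smul Complex.I Complex.I_ne_zero, ?_, ?_⟩
    · rw [smul_comm]
      exact hL.smul Complex.I_ne_zero
    · rw [LinearSystemMatrix.smul_toMatrix]
      exact LinearSystemMatrix.isStarPalindromic_smul_I hpal
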